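/- Let $R$ be an associative ring with identity that is both left and right Noetherian. For a (left or right) $R$-module $M$, let $E^0(M)$ denote the injective envelope of $M$. A left $R$-module $M$ is called Gorenstein flat if there is an exact sequence $$\cdots \to F_1 \to F_0 \to F^0 \to F^1 \to \cdots$$ of flat left $R$-modules with $M \cong \operatorname{Im}(F_0 \to F^0)$ that remains exact after applying $I \otimes_R -$ for every injective right $R$-module $I$; Gorenstein flat right $R$-modules are defined symmetrically. Write ${}_RR$ and $R_R$ for $R$ regarded as a left and as a right module over itself. Then the following six statements are equivalent. 1. $E^0({}_RR)$ is flat. 2. $E^0(F)$ is flat for every flat left $R$-module $F$. 3. $E^0({}_RR)$ is Gorenstein flat. 4. $E^0(R_R)$ is flat. 5. $E^0(F)$ is flat for every flat right $R$-module $F$. 6. $E^0(R_R)$ is Gorenstein flat. -/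

import Mathlib

/-!
Conventions.  Rings are associative and unital.  A left `R`-module is a `Module R M`; a right
`R`-module is a `Module Rᵐᵒᵖ N`, where `MulOpposite.op r • x` is `x · r`.  For a ring `R : Type u`
the category of left (right) `R`-modules consists of the modules in `Type u`.
-/

universe u

namespace GorFlat

open scoped TensorProduct

/-! ### Injective envelopes -/

/-- `ι : M → E` is an injective envelope of `M`: a monomorphism into an injective module whose
image is essential, i.e. meets every nonzero submodule of `E` nontrivially. -/
structure IsInjectiveEnvelope {R : Type u} [Ring R] {M E : Type u} [AddCommGroup M] [Module R M]
    [AddCommGroup E] [Module R E] (ι : M →ₗ[R] E) : Prop where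
  injective : Function.Injective ι
  injective_module : Module.Injective R E
  essential : ∀ K : Submodule R E, K ⊓ LinearMap.range ι = ⊥ → K = ⊥

/-- Every submodule `P` of `I` has a maximal essential extension inside `I`. -/
theorem exists_maximal_essential {R : Type u} [Ring R] {I : Type u} [AddCommGroup I] [Module R I]
    (P : Submodule R I) :
    ∃ N : Submodule R I, Maximal (fun N => P ≤ N ∧ ∀ K ≤ N, K ⊓ P = ⊥ → K = ⊥) N := by
  have hz := zorn_le_nonempty₀ {N : Submodule R I | P ≤ N ∧ ∀ K ≤ N, K ⊓ P = ⊥ → K = ⊥} ?_ P ?_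
  · obtain ⟨N, -, hN⟩ := hz
    exact ⟨N, hN⟩
  · intro c hc hchain y hy
    refine ⟨sSup c, ⟨(hc hy).1.trans (le_sSup hy), ?_⟩, fun z hz => le_sSup hz⟩
    intro K hK hKP
    rw [Submodule.eq_bot_iff]
    intro x hx
    obtain ⟨N, hN, hxN⟩ := (Submodule.mem_sSup_of_directed ⟨y, hy⟩ hchain.directedOn).1 (hK hx)
    have hb := (hc hN).2 (R ∙ x) ((Submodule.span_singleton_le_iff_mem _ _).2 hxN) (by
      rw [eq_bot_iff, ← hKP]
      exact inf_le_inf_right _ ((Submodule.span_singleton_le_iff_mem _ _).2 hx))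
    exact (Submodule.span_singleton_eq_bot).1 hb
  · refine ⟨le_rfl, fun K hK h => ?_⟩
    rwa [inf_eq_left.2 hK] at h

/-- Every submodule `N` of `I` has a maximal submodule meeting it trivially. -/
theorem exists_maximal_disjoint {R : Type u} [Ring R] {I : Type u} [AddCommGroup I] [Module R I]
    (N : Submodule R I) : ∃ C : Submodule R I, Maximal (fun C => C ⊓ N = ⊥) C := by
  have hz := zorn_le_nonempty₀ {C : Submodule R I | C ⊓ N = ⊥} ?_ ⊥ ?_
  · obtain ⟨C, -, hC⟩ := hz
    exact ⟨C, hC⟩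
  · intro c hc hchain y hy
    refine ⟨sSup c, ?_, fun z hz => le_sSup hz⟩
    change sSup c ⊓ N = ⊥
    rw [Submodule.eq_bot_iff]
    rintro x ⟨hx, hxN⟩
    obtain ⟨C, hC, hxC⟩ := (Submodule.mem_sSup_of_directed ⟨y, hy⟩ hchain.directedOn).1 hx
    have h : x ∈ C ⊓ N := ⟨hxC, hxN⟩
    rw [show C ⊓ N = ⊥ from hc hC] at h
    simpa using h
  · exact bot_inf_eq _

/-- Every module has an injective envelope. -/
theorem exists_injectiveEnvelope (R : Type u) [Ring R] (M : Type u) [AddCommGroup M]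
    [Module R M] :
    ∃ (E : ModuleCat.{u} R) (ι : M →ₗ[R] E), IsInjectiveEnvelope ι := by
  obtain ⟨J⟩ := CategoryTheory.EnoughInjectives.presentation (ModuleCat.of R M)
  obtain ⟨I, hIinj, f, hf⟩ : ∃ (I : ModuleCat.{u} R) (_ : CategoryTheory.Injective I)
      (f : ModuleCat.of R M ⟶ I), CategoryTheory.Mono f := ⟨J.J, J.injective, J.f, J.mono⟩
  have hI : Module.Injective R I := Module.injective_module_of_injective_object R I
  have hfi : Function.Injective f.hom := (ModuleCat.mono_iff_injective f).1 hf
  obtain ⟨N, ⟨hPN, hess⟩, hmax⟩ := exists_maximal_essential (LinearMap.range f.hom)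
  obtain ⟨C, hC, hCmax⟩ := exists_maximal_disjoint N
  -- the composite `N → I → I ⧸ C` is an essential monomorphism
  have hπ : Function.Injective (C.mkQ ∘ₗ N.subtype) := by
    rw [← LinearMap.ker_eq_bot, LinearMap.ker_eq_bot']
    rintro ⟨x, hx⟩ h
    have hxC : x ∈ C := by simpa using h
    have h' : x ∈ C ⊓ N := ⟨hxC, hx⟩
    rw [hC] at h'
    exact Subtype.ext (by simpa using h')
  obtain ⟨φ, hφ⟩ := hI.out (C.mkQ ∘ₗ N.subtype) hπ N.subtype
  have hφN : ∀ x ∈ N, φ (C.mkQ x) = x := fun x hx => hφ ⟨x, hx⟩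
  have hdis : ∀ L : Submodule R I, C ≤ L → L ⊓ N = ⊥ → L ≤ C := fun L h1 h2 => hCmax h2 h1
  have hrange : LinearMap.range (φ ∘ₗ C.mkQ) ≤ N := by
    refine hmax ⟨?_, ?_⟩ ?_
    · exact fun x hx => ⟨x, hφN x (hPN hx)⟩
    · intro K hK hKP
      -- the preimage of `K` meets `N` trivially
      have hKN : K ⊓ N = ⊥ := hess _ inf_le_right (by
        rw [eq_bot_iff, ← hKP]
        exact inf_le_inf_right _ inf_le_left)
      have hker : LinearMap.ker (φ ∘ₗ C.mkQ) ≤ C := by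
        refine hdis _ (fun x hx => ?_) ?_
        · have : C.mkQ x = 0 := by simpa using hx
          simp only [LinearMap.mem_ker, LinearMap.comp_apply, this, map_zero]
        · rw [Submodule.eq_bot_iff]
          rintro x ⟨hx, hxN⟩
          rw [← hφN x hxN]
          exact hx
      have hcomap : K.comap (φ ∘ₗ C.mkQ) ≤ C := by
        refine hdis _ (fun x hx => ?_) ?_
        · have : C.mkQ x = 0 := by simpa using hx
          simp only [Submodule.mem_comap, LinearMap.comp_apply, this, map_zero, K.zero_mem]
        · rw [Submodule.eq_bot_iff]
          rintro x ⟨hx, hxN⟩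
          have hxK : x ∈ K := by
            rw [← hφN x hxN]
            exact hx
          have h : x ∈ K ⊓ N := ⟨hxK, hxN⟩
          rw [hKN] at h
          simpa using h
      rw [Submodule.eq_bot_iff]
      intro y hy
      obtain ⟨x, rfl⟩ := hK hy
      have hxC : C.mkQ x = 0 := by simpa using hcomap hy
      simp only [LinearMap.comp_apply, hxC, map_zero]
    · exact fun x hx => ⟨x, hφN x hx⟩
  -- hence `N` is a retract of `I`
  let r : I →ₗ[R] N := (φ ∘ₗ C.mkQ).codRestrict N (fun x => hrange ⟨x, rfl⟩)
  have hr : ∀ x : N, r x = x := fun x => Subtype.ext (hφN x x.2)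
  refine ⟨ModuleCat.of R N, f.hom.codRestrict N (fun x => hPN ⟨x, rfl⟩), ⟨?_, ⟨?_⟩, ?_⟩⟩
  · intro x y h
    exact hfi (congrArg Subtype.val h)
  · intro X Y _ _ _ _ g hg k
    obtain ⟨h, hh⟩ := hI.out g hg (N.subtype ∘ₗ k)
    refine ⟨r ∘ₗ h, fun x => ?_⟩
    have : h (g x) = ((k x : N) : I) := hh x
    simp only [LinearMap.comp_apply, this]
    exact hr (k x)
  · intro K hK
    have hb : Submodule.map N.subtype K = ⊥ := by
      refine hess _ (Submodule.map_subtype_le _ _) ?_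
      rw [Submodule.eq_bot_iff]
      rintro x ⟨⟨z, hz, rfl⟩, ⟨m, hm⟩⟩
      have h : z ∈ K ⊓ LinearMap.range (f.hom.codRestrict N (fun x => hPN ⟨x, rfl⟩)) :=
        ⟨hz, ⟨m, Subtype.ext hm⟩⟩
      rw [hK] at h
      have hz0 : z = 0 := by simpa using h
      simp [hz0]
    exact Submodule.map_injective_of_injective N.injective_subtype (by rw [hb, Submodule.map_bot])

/-- The injective envelope `E⁰(M)` of an `R`-module `M` (unique up to isomorphism).
For a right module `N` over `R`, the envelope is `E0 Rᵐᵒᵖ N`. -/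
noncomputable def E0 (R : Type u) [Ring R] (M : Type u) [AddCommGroup M] [Module R M] :
    ModuleCat.{u} R :=
  (exists_injectiveEnvelope R M).choose

/-- The inclusion `M → E⁰(M)`. -/
noncomputable def E0.ι (R : Type u) [Ring R] (M : Type u) [AddCommGroup M] [Module R M] :
    M →ₗ[R] E0 R M :=
  (exists_injectiveEnvelope R M).choose_spec.choose

theorem E0.isInjectiveEnvelope (R : Type u) [Ring R] (M : Type u) [AddCommGroup M] [Module R M] :
    IsInjectiveEnvelope (E0.ι R M) :=
  (exists_injectiveEnvelope R M).choose_spec.choose_spec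

/-! ### The tensor product over a noncommutative ring -/

/-- The subgroup of `N ⊗_ℤ M` generated by all `(x · r) ⊗ y - x ⊗ (r · y)`. -/
def balancedRel (R : Type u) [Ring R] (N M : Type u) [AddCommGroup N] [Module Rᵐᵒᵖ N]
    [AddCommGroup M] [Module R M] : AddSubgroup (N ⊗[ℤ] M) :=
  AddSubgroup.closure
    {t | ∃ (x : N) (r : R) (y : M), t = (MulOpposite.op r • x) ⊗ₜ[ℤ] y - x ⊗ₜ[ℤ] (r • y)}

/-- The abelian group `N ⊗_R M`, for a right `R`-module `N` and a left `R`-module `M`. -/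
abbrev Tensor (R : Type u) [Ring R] (N M : Type u) [AddCommGroup N] [Module Rᵐᵒᵖ N]
    [AddCommGroup M] [Module R M] : Type u :=
  (N ⊗[ℤ] M) ⧸ balancedRel R N M

/-- The additive map `f ⊗ g : N ⊗_R M → N' ⊗_R M'`. -/
noncomputable def Tensor.map {R : Type u} [Ring R] {N N' M M' : Type u}
    [AddCommGroup N] [Module Rᵐᵒᵖ N] [AddCommGroup N'] [Module Rᵐᵒᵖ N']
    [AddCommGroup M] [Module R M] [AddCommGroup M'] [Module R M']
    (f : N →ₗ[Rᵐᵒᵖ] N') (g : M →ₗ[R] M') : Tensor R N M →+ Tensor R N' M' :=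
  QuotientAddGroup.map _ _
    (TensorProduct.map f.toAddMonoidHom.toIntLinearMap
      g.toAddMonoidHom.toIntLinearMap).toAddMonoidHom (by
      rw [balancedRel, AddSubgroup.closure_le]
      rintro _ ⟨x, r, y, rfl⟩
      refine AddSubgroup.subset_closure ⟨f x, r, g y, ?_⟩
      simp)

/-! ### Flat and Gorenstein flat modules -/

/-- The left `R`-module `M` is flat: `- ⊗_R M` preserves monomorphisms of right `R`-modules. -/
def IsFlatLeft (R : Type u) [Ring R] (M : Type u) [AddCommGroup M] [Module R M] : Prop :=
  ∀ (A B : Type u) [AddCommGroup A] [Module Rᵐᵒᵖ A] [AddCommGroup B] [Module Rᵐᵒᵖ B]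
    (f : A →ₗ[Rᵐᵒᵖ] B), Function.Injective f →
      Function.Injective (Tensor.map f (LinearMap.id : M →ₗ[R] M))

/-- The right `R`-module `N` is flat: `N ⊗_R -` preserves monomorphisms of left `R`-modules. -/
def IsFlatRight (R : Type u) [Ring R] (N : Type u) [AddCommGroup N] [Module Rᵐᵒᵖ N] : Prop :=
  ∀ (A B : Type u) [AddCommGroup A] [Module R A] [AddCommGroup B] [Module R B]
    (f : A →ₗ[R] B), Function.Injective f →
      Function.Injective (Tensor.map (LinearMap.id : N →ₗ[Rᵐᵒᵖ] N) f)

/-- The left `R`-module `M` is Gorenstein flat: there is an exact sequence of flat left modules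
`⋯ → F (-2) → F (-1) → F 0 → F 1 → ⋯` with `M ≅ Im (F (-1) → F 0)` that remains exact under
`I ⊗_R -` for every injective right module `I`. -/
def IsGorensteinFlatLeft (R : Type u) [Ring R] (M : Type u) [AddCommGroup M] [Module R M] :
    Prop :=
  ∃ (F : ℤ → ModuleCat.{u} R) (d : ∀ n : ℤ, F n →ₗ[R] F (n + 1)),
    (∀ n, IsFlatLeft R (F n)) ∧
    (∀ n, Function.Exact (d n) (d (n + 1))) ∧
    Nonempty (M ≃ₗ[R] LinearMap.range (d (-1))) ∧
    ∀ (I : Type u) [AddCommGroup I] [Module Rᵐᵒᵖ I], Module.Injective Rᵐᵒᵖ I →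
      ∀ n, Function.Exact (Tensor.map (LinearMap.id : I →ₗ[Rᵐᵒᵖ] I) (d n))
        (Tensor.map (LinearMap.id : I →ₗ[Rᵐᵒᵖ] I) (d (n + 1)))

/-- The right `R`-module `N` is Gorenstein flat: there is an exact sequence of flat right modules
`⋯ → F (-2) → F (-1) → F 0 → F 1 → ⋯` with `N ≅ Im (F (-1) → F 0)` that remains exact under
`- ⊗_R I` for every injective left module `I`. -/
def IsGorensteinFlatRight (R : Type u) [Ring R] (N : Type u) [AddCommGroup N] [Module Rᵐᵒᵖ N] :
    Prop :=
  ∃ (F : ℤ → ModuleCat.{u} Rᵐᵒᵖ) (d : ∀ n : ℤ, F n →ₗ[Rᵐᵒᵖ] F (n + 1)),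
    (∀ n, IsFlatRight R (F n)) ∧
    (∀ n, Function.Exact (d n) (d (n + 1))) ∧
    Nonempty (N ≃ₗ[Rᵐᵒᵖ] LinearMap.range (d (-1))) ∧
    ∀ (I : Type u) [AddCommGroup I] [Module R I], Module.Injective R I →
      ∀ n, Function.Exact (Tensor.map (d n) (LinearMap.id : I →ₗ[R] I))
        (Tensor.map (d (n + 1)) (LinearMap.id : I →ₗ[R] I))

end GorFlat

namespace GorFlat

open scoped TensorProduct

/-! ### Extending maps into injective modules -/

/-! The bridge between the two sides is the character module `M⁺ = Hom_ℤ(M, ℚ/ℤ)`. A module is flat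
exactly when its dual is injective (`EquationallyFlat.baer_dual`, `EquationallyFlat.of_baer_dual`),
and over a Noetherian ring the dual of an injective module is flat
(`EquationallyFlat.dual_of_baer`). So if `S` embeds in a flat injective module `E`, then `E⁺` is
flat and injective over the opposite ring. A product of copies of `E⁺` has the same two properties
and contains that ring, since `E⁺` is faithful (`HasFlatInjectiveExtension.opposite`).

Such an `E` also controls every flat module `F`: maps `F → E` separate points
(`EquationallyFlat.exists_map_ne_zero`), so `F` embeds in a power of `E`, and the envelope of `F` is
a direct summand of that power (`HasFlatInjectiveExtension.E0`). This crosses sides in both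
directions, 1 → 5 and 4 → 2. The Gorenstein conditions reduce to flatness because an injective
submodule of a flat module is a summand.

Flatness is handled through relations among elements, which avoids tensor products until
`isFlatLeft_iff` and `isFlatRight_iff`. The isomorphism `τ : T ≃+* Sᵐᵒᵖ` lets each lemma serve left
and right modules alike. -/

theorem exists_comp_eq_of_ker_le {R Q A B : Type*} [Ring R] [AddCommGroup Q] [Module R Q]
    [AddCommGroup A] [Module R A] [AddCommGroup B] [Module R B] (hQ : Module.Baer R Q)
    (f : A →ₗ[R] B) (g : A →ₗ[R] Q) (h : LinearMap.ker f ≤ LinearMap.ker g) :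
    ∃ k : B →ₗ[R] Q, ∀ x, k (f x) = g x := by
  obtain ⟨k, hk⟩ := hQ.extension_property ((LinearMap.ker f).liftQ f le_rfl)
    (LinearMap.ker_eq_bot.1 (Submodule.ker_liftQ_eq_bot _ _ _ le_rfl))
    ((LinearMap.ker f).liftQ g h)
  refine ⟨k, fun x => ?_⟩
  simpa using LinearMap.congr_fun hk (Submodule.Quotient.mk x)

theorem exists_character_comp_eq {A B : Type*} [AddCommGroup A] [AddCommGroup B]
    (f : A →+ B) (g : A →+ AddCircle (1 : ℚ)) (h : ∀ x, f x = 0 → g x = 0) :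
    ∃ k : B →+ AddCircle (1 : ℚ), ∀ x, k (f x) = g x := by
  obtain ⟨k, hk⟩ := exists_comp_eq_of_ker_le (Module.Baer.of_divisible (AddCircle (1 : ℚ)))
    f.toIntLinearMap g.toIntLinearMap h
  exact ⟨k.toAddMonoidHom, hk⟩

theorem exists_character_ne_zero {A : Type*} [AddCommGroup A] {x : A} (hx : x ≠ 0) :
    ∃ χ : A →+ AddCircle (1 : ℚ), χ x ≠ 0 :=
  CharacterModule.exists_character_apply_ne_zero_of_ne_zero hx

/-- A system of equations `w i = a i • z` is solvable in an injective module as soon as `w`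
satisfies all linear relations among the `a i`. -/
theorem exists_smul_eq_of_baer {T J : Type*} [Ring T] [AddCommGroup J] [Module T J]
    (hJ : Module.Baer T J) {n : ℕ} (a : Fin n → T) (w : Fin n → J)
    (h : ∀ b : Fin n → T, ∑ i, b i * a i = 0 → ∑ i, b i • w i = 0) :
    ∃ z : J, ∀ i, w i = a i • z := by
  obtain ⟨k, hk⟩ := exists_comp_eq_of_ker_le hJ (Fintype.linearCombination T a)
    (Fintype.linearCombination T w) (fun b hb => by
      simpa [Fintype.linearCombination_apply] using
        h b (by simpa [Fintype.linearCombination_apply] using hb))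
  refine ⟨k 1, fun i => ?_⟩
  have := hk (Pi.single i 1)
  simp only [Fintype.linearCombination_apply_single, one_smul] at this
  rw [← this, ← map_smul, smul_eq_mul, mul_one]

/-! ### The equational criterion for flatness -/

/-- Every linear relation in `M` is a consequence of relations in the ring. -/
def EquationallyFlat (S : Type*) [Ring S] (M : Type*) [AddCommGroup M] [Module S M] : Prop :=
  ∀ (n : ℕ) (a : Fin n → S) (x : Fin n → M), ∑ i, a i • x i = 0 →
    ∃ (k : ℕ) (b : Fin n → Fin k → S) (y : Fin k → M),
      (∀ i, x i = ∑ j, b i j • y j) ∧ ∀ j, ∑ i, a i * b i j = 0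

namespace EquationallyFlat

variable {S : Type*} [Ring S] {M : Type*} [AddCommGroup M] [Module S M]

theorem exists_of_fintype (hM : EquationallyFlat S M) {ι : Type*} [Fintype ι] (a : ι → S)
    (x : ι → M) (h : ∑ i, a i • x i = 0) :
    ∃ (k : ℕ) (b : ι → Fin k → S) (y : Fin k → M),
      (∀ i, x i = ∑ j, b i j • y j) ∧ ∀ j, ∑ i, a i * b i j = 0 := by
  let e := Fintype.equivFin ι
  obtain ⟨k, b, y, hx, hb⟩ := hM _ (a ∘ e.symm) (x ∘ e.symm) (by
    rw [← h]
    exact e.symm.sum_comp (fun i => a i • x i))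
  refine ⟨k, fun i => b (e i), y, fun i => by simpa using hx (e i), fun j => ?_⟩
  rw [← hb j, ← e.sum_comp]
  simp

/-- Solve the first equation, rewrite the remaining ones in the new elements `y`, and recurse; the
coefficient matrices multiply. -/
theorem exists_of_system (hM : EquationallyFlat S M) (m : ℕ) :
    ∀ (n : ℕ) (A : Fin m → Fin n → S) (x : Fin n → M), (∀ l, ∑ i, A l i • x i = 0) →
    ∃ (k : ℕ) (b : Fin n → Fin k → S) (y : Fin k → M),
      (∀ i, x i = ∑ j, b i j • y j) ∧ ∀ l j, ∑ i, A l i * b i j = 0 := by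
  induction m with
  | zero =>
    intro n A x _
    exact ⟨n, fun i j => if i = j then 1 else 0, x, fun i => by simp, fun l => l.elim0⟩
  | succ m ih =>
    intro n A x h
    obtain ⟨k, b, y, hx, hb⟩ := hM n (A 0) x (h 0)
    obtain ⟨k', c, z, hy, hc⟩ := ih k (fun l j => ∑ i, A l.succ i * b i j) y (fun l => by
      rw [← h l.succ]
      simp_rw [hx, Finset.smul_sum, Finset.sum_smul, smul_smul]
      exact Finset.sum_comm)
    refine ⟨k', fun i j' => ∑ j, b i j * c j j', z, fun i => ?_, fun l j' => ?_⟩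
    · rw [hx i]
      simp_rw [hy, Finset.smul_sum, Finset.sum_smul, smul_smul]
      exact Finset.sum_comm
    · have hswap : ∀ l, ∑ i, A l i * ∑ j, b i j * c j j' =
          ∑ j, (∑ i, A l i * b i j) * c j j' := fun l => by
        simp_rw [Finset.mul_sum, Finset.sum_mul, mul_assoc]
        exact Finset.sum_comm
      rw [hswap]
      refine Fin.cases ?_ (fun l => ?_) l
      · simp [hb]
      · exact hc l j'

theorem of_retract {F : Type*} [AddCommGroup F] [Module S F] (hF : EquationallyFlat S F)
    (i : M →ₗ[S] F) (r : F →ₗ[S] M) (h : ∀ x, r (i x) = x) : EquationallyFlat S M := by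
  intro n a x hx
  obtain ⟨k, b, y, hy, hb⟩ := hF n a (fun j => i (x j)) (by
    simp_rw [← map_smul, ← map_sum, hx, map_zero])
  refine ⟨k, b, fun j => r (y j), fun j => ?_, hb⟩
  rw [← h (x j), hy j, map_sum]
  simp

theorem self (S : Type*) [Ring S] : EquationallyFlat S S := by
  intro n a x h
  exact ⟨1, fun i _ => x i, fun _ => 1, fun i => by simp, fun _ => by simpa using h⟩

end EquationallyFlat

/-! ### Dual modules -/

section Dual

variable {S T : Type*} [Ring S] [Ring T]

/-- The group of characters of an `S`-module, as a module over `T ≃+* Sᵐᵒᵖ`. -/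
def Dual (_ : T ≃+* Sᵐᵒᵖ) (M : Type*) [AddCommGroup M] : Type _ :=
  M →+ AddCircle (1 : ℚ)

variable (τ : T ≃+* Sᵐᵒᵖ) (M : Type*) [AddCommGroup M]

noncomputable instance : AddCommGroup (Dual τ M) :=
  inferInstanceAs (AddCommGroup (M →+ AddCircle (1 : ℚ)))

variable {τ M}

/-- The identity, as an additive equivalence between the dual and the group of characters. -/
noncomputable def Dual.toHom :
    Dual τ M ≃+ (M →+ AddCircle (1 : ℚ)) :=
  AddEquiv.refl _

theorem Dual.sum_apply {ι : Type*} (s : Finset ι) (φ : ι → Dual τ M) (x : M) :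
    (∑ i ∈ s, φ i).toHom x = ∑ i ∈ s, (φ i).toHom x := by
  rw [map_sum, AddMonoidHom.finsetSum_apply]

theorem Dual.ext {φ ψ : Dual τ M} (h : ∀ x, φ.toHom x = ψ.toHom x) : φ = ψ :=
  AddMonoidHom.ext h

variable (τ M) [Module S M]

noncomputable instance : Module T (Dual τ M) where
  smul t φ := (Dual.toHom φ).comp
    (DistribSMul.toAddMonoidHom M (τ t).unop)
  one_smul φ := AddMonoidHom.ext fun x => by
    change φ.toHom ((τ 1).unop • x) = φ.toHom x
    simp
  mul_smul s t φ := AddMonoidHom.ext fun x => by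
    change φ.toHom ((τ (s * t)).unop • x) =
      φ.toHom ((τ t).unop • (τ s).unop • x)
    simp [mul_smul]
  smul_zero t := rfl
  smul_add t φ ψ := rfl
  add_smul s t φ := AddMonoidHom.ext fun x => by
    change φ.toHom ((τ (s + t)).unop • x) =
      φ.toHom ((τ s).unop • x) +
      φ.toHom ((τ t).unop • x)
    simp [add_smul]
  zero_smul φ := AddMonoidHom.ext fun x => by
    change φ.toHom ((τ 0).unop • x) = 0
    simp

variable {τ M}

theorem Dual.smul_apply (t : T) (φ : Dual τ M) (x : M) :
    (t • φ).toHom x = φ.toHom ((τ t).unop • x) :=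
  rfl

/-- Flat modules have injective duals. -/
theorem EquationallyFlat.baer_dual (hM : EquationallyFlat S M) :
    Module.Baer T (Dual τ M) := by
  intro J g
  -- Baer's criterion asks for `ψ` with `g a = a • ψ`, that is, a character taking prescribed values
  -- on the elements `a • x`. It exists once `G` vanishes on `ker p`; flatness turns an element of
  -- `ker p` into relations among elements of `J`, which `g` respects.
  let p : (J →₀ M) →+ M :=
    Finsupp.liftAddHom fun a => DistribSMul.toAddMonoidHom M (τ (a : T)).unop
  let G : (J →₀ M) →+ AddCircle (1 : ℚ) := Finsupp.liftAddHom fun a => (g a).toHom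
  obtain ⟨ψ, hψ⟩ := exists_character_comp_eq p G (fun f hf => by
    have hf' : ∑ a : f.support, (τ ((a : J) : T)).unop • f a = 0 := by
      rw [Finset.sum_coe_sort f.support (fun a => (τ (a : T)).unop • f a)]
      exact hf
    obtain ⟨k, b, y, hx, hb⟩ := hM.exists_of_fintype _ _ hf'
    have hz : ∀ j, ∑ a : f.support, τ.symm (MulOpposite.op (b a j)) • (a : J) = 0 := fun j => by
      apply Subtype.ext
      rw [AddSubmonoidClass.coe_finsetSum]
      apply τ.injective
      apply MulOpposite.unop_injective
      rw [ZeroMemClass.coe_zero, map_zero, MulOpposite.unop_zero, ← hb j, map_sum,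
        Finset.unop_sum]
      simp
    have hG : G f = ∑ a : f.support, (g a).toHom (f a) := by
      rw [Finset.sum_coe_sort f.support (fun a => (g a).toHom (f a))]
      rfl
    calc G f = ∑ a : f.support, ∑ j, (g a).toHom (b a j • y j) := by
          rw [hG]
          exact Finset.sum_congr rfl fun a _ => by rw [hx a, map_sum]
      _ = ∑ j, ∑ a : f.support, (g a).toHom (b a j • y j) := Finset.sum_comm
      _ = ∑ j, (g (∑ a : f.support, τ.symm (MulOpposite.op (b a j)) • (a : J))).toHom (y j) := by
          refine Finset.sum_congr rfl fun j _ => ?_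
          rw [map_sum, Dual.sum_apply]
          refine Finset.sum_congr rfl fun a _ => ?_
          rw [g.map_smul, Dual.smul_apply]
          simp
      _ = 0 := by simp only [hz, map_zero, AddMonoidHom.zero_apply, Finset.sum_const_zero])
  refine ⟨LinearMap.toSpanSingleton T (Dual τ M) (Dual.toHom.symm ψ), fun a ha => ?_⟩
  refine Dual.ext fun x => ?_
  have := hψ (Finsupp.single ⟨a, ha⟩ x)
  simp only [p, G, Finsupp.liftAddHom_apply_single] at this
  exact this

/-- Modules with injective duals are flat. -/
theorem EquationallyFlat.of_baer_dual (h : Module.Baer T (Dual τ M)) : EquationallyFlat S M := by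
  intro n a x hx
  -- `K` consists of the solutions that come from relations in the ring. A character separating `x`
  -- from `K` has components satisfying every relation of the `a i`, so by injectivity they are
  -- multiples of a single `ψ`; then its value at `x` is `ψ (∑ a i • x i) = 0`.
  let K : AddSubgroup (Fin n → M) := AddSubgroup.closure
    {v | ∃ (b : Fin n → S) (y : M), ∑ i, a i * b i = 0 ∧ v = fun i => b i • y}
  have hxK : x ∈ K := by
    by_contra hxK
    obtain ⟨χ, hχ⟩ := exists_character_ne_zero (A := (Fin n → M) ⧸ K)
      (x := QuotientAddGroup.mk x) (by rwa [ne_eq, QuotientAddGroup.eq_zero_iff])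
    let Φ : (Fin n → M) →+ AddCircle (1 : ℚ) := χ.comp (QuotientAddGroup.mk' K)
    have hΦ : ∀ v, Φ v = ∑ i, Φ (Pi.single i (v i)) := fun v => by
      rw [← map_sum, Finset.univ_sum_single]
    let φ : Fin n → Dual τ M := fun i =>
      Dual.toHom.symm (Φ.comp (AddMonoidHom.single (fun _ => M) i))
    obtain ⟨ψ, hψ⟩ := exists_smul_eq_of_baer h (fun i => τ.symm (MulOpposite.op (a i))) φ
      (fun b hb => by
        refine Dual.ext fun y => ?_
        rw [Dual.sum_apply]
        change ∑ i, Φ (Pi.single i ((τ (b i)).unop • y)) = 0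
        rw [← hΦ (fun i => (τ (b i)).unop • y)]
        change χ (QuotientAddGroup.mk _) = 0
        rw [(QuotientAddGroup.eq_zero_iff _).2, map_zero]
        refine AddSubgroup.subset_closure ⟨_, y, ?_, rfl⟩
        have := congrArg (fun t => (τ t).unop) hb
        simpa [map_sum, Finset.unop_sum] using this)
    apply hχ
    change Φ x = 0
    rw [hΦ]
    have : ∀ i, Φ (Pi.single i (x i)) = ψ.toHom (a i • x i) := fun i => by
      change (φ i).toHom (x i) = _
      rw [hψ i, Dual.smul_apply]
      simp
    simp_rw [this, ← map_sum, hx, map_zero]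
  suffices H : ∀ v ∈ K, ∃ (k : ℕ) (b : Fin n → Fin k → S) (y : Fin k → M),
      (∀ i, v i = ∑ j, b i j • y j) ∧ ∀ j, ∑ i, a i * b i j = 0 from H x hxK
  intro v hv
  induction hv using AddSubgroup.closure_induction with
  | mem v hv =>
    obtain ⟨b, y, hb, rfl⟩ := hv
    exact ⟨1, fun i _ => b i, fun _ => y, fun i => by simp, fun _ => hb⟩
  | zero => exact ⟨0, fun _ => Fin.elim0, Fin.elim0, fun i => by simp, fun j => j.elim0⟩
  | add v w _ _ hv hw =>
    obtain ⟨k, b, y, h1, h2⟩ := hv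
    obtain ⟨l, c, z, h3, h4⟩ := hw
    refine ⟨k + l, fun i => Fin.append (b i) (c i), Fin.append y z, fun i => ?_, fun j => ?_⟩
    · simp [Fin.sum_univ_add, h1, h3]
    · refine Fin.addCases (fun j => ?_) (fun j => ?_) j
      · simpa using h2 j
      · simpa using h4 j
  | neg v _ hv =>
    obtain ⟨k, b, y, h1, h2⟩ := hv
    exact ⟨k, b, fun j => - y j, fun i => by simp [h1], h2⟩

/-- Over a Noetherian ring, injective modules have flat duals. -/
theorem EquationallyFlat.dual_of_baer [IsNoetherianRing S] (hM : Module.Baer S M) :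
    EquationallyFlat T (Dual τ M) := by
  intro n a φ h
  let a' : Fin n → S := fun i => (τ (a i)).unop
  obtain ⟨k, c, hc⟩ := Submodule.fg_iff_exists_fin_generating_family.1
    (IsNoetherian.noetherian (LinearMap.ker (Fintype.linearCombination S a')))
  -- The rows `c j` generate the relations among the `a' i`, so by injectivity `ker W` consists of
  -- the vectors `a' i • z`, on which `Φ` vanishes. Factoring `Φ` through `W` writes each `φ i` as a
  -- combination with coefficients `c j i`.
  let W : (Fin n → M) →+ (Fin k → M) := AddMonoidHom.mk' (fun w j => ∑ i, c j i • w i) (by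
    intro v w
    ext j
    simp [Finset.sum_add_distrib])
  let Φ : (Fin n → M) →+ AddCircle (1 : ℚ) :=
    AddMonoidHom.mk' (fun w => ∑ i, (φ i).toHom (w i)) (by
      intro v w
      simp [Finset.sum_add_distrib])
  obtain ⟨ψ, hψ⟩ := exists_character_comp_eq W Φ (fun w hw => by
    obtain ⟨z, hz⟩ := exists_smul_eq_of_baer hM a' w (fun b hb => by
      have hb' : b ∈ Submodule.span S (Set.range c) := by
        rw [hc]
        simpa [Fintype.linearCombination_apply] using hb
      have hle : Submodule.span S (Set.range c) ≤
          LinearMap.ker ((Fintype.linearCombination S w)) := by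
        rw [Submodule.span_le]
        rintro _ ⟨j, rfl⟩
        exact congrFun hw j
      simpa [Fintype.linearCombination_apply] using hle hb')
    change ∑ i, (φ i).toHom (w i) = 0
    have h0 := congrArg (fun ξ : Dual τ M => ξ.toHom z) h
    simp only [Dual.sum_apply, Dual.smul_apply, map_zero, AddMonoidHom.zero_apply] at h0
    rw [← h0]
    exact Finset.sum_congr rfl fun i _ => by rw [hz i])
  refine ⟨k, fun i j => τ.symm (MulOpposite.op (c j i)), fun j =>
    Dual.toHom.symm (ψ.comp (AddMonoidHom.single (fun _ => M) j)), fun i => ?_, fun j => ?_⟩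
  · refine Dual.ext fun y => ?_
    have hΦ : (φ i).toHom y = Φ (Pi.single i y) := by
      change _ = ∑ l, (φ l).toHom ((Pi.single i y : Fin n → M) l)
      rw [Finset.sum_eq_single i (fun l _ hl => by simp [hl]) (by simp)]
      simp
    rw [hΦ, ← hψ, Dual.sum_apply, ← Finset.univ_sum_single (W (Pi.single i y)), map_sum]
    refine Finset.sum_congr rfl fun j _ => ?_
    rw [Dual.smul_apply]
    change _ = ψ (Pi.single j _)
    congr 2
    change ∑ l, c j l • (Pi.single i y : Fin n → M) l = _
    rw [Finset.sum_eq_single i (fun l _ hl => by simp [hl]) (by simp)]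
    simp
  · have hj : c j ∈ LinearMap.ker (Fintype.linearCombination S a') := by
      rw [← hc]
      exact Submodule.subset_span ⟨j, rfl⟩
    apply τ.injective
    apply MulOpposite.unop_injective
    simpa [map_sum, Finset.unop_sum, Fintype.linearCombination_apply, a'] using hj

/-- Over a ring whose opposite is Noetherian, products of flat modules are flat. -/
theorem EquationallyFlat.pi [IsNoetherianRing T] (τ : T ≃+* Sᵐᵒᵖ) {ι : Type*} {P : ι → Type*}
    [∀ α, AddCommGroup (P α)] [∀ α, Module S (P α)] (h : ∀ α, EquationallyFlat S (P α)) :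
    EquationallyFlat S (∀ α, P α) := by
  intro n a x hx
  let a' : Fin n → T := fun i => τ.symm (MulOpposite.op (a i))
  obtain ⟨k, c, hc⟩ := Submodule.fg_iff_exists_fin_generating_family.1
    (IsNoetherian.noetherian (LinearMap.ker (Fintype.linearCombination T a')))
  -- The coefficients `c` do not depend on `α`: they come from finitely many generators of all
  -- relations. Hence the coordinatewise solutions assemble into one solution in the product.
  have key : ∀ α, ∃ y : Fin k → P α, ∀ i, x i α = ∑ l, (τ (c l i)).unop • y l := by
    intro α
    obtain ⟨m, b, z, hz, hb⟩ := h α n a (fun i => x i α) (by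
      simpa using congrFun hx α)
    have hs : ∀ j, ∃ s : Fin k → T, ∑ l, s l • c l = fun i => τ.symm (MulOpposite.op (b i j)) := by
      intro j
      rw [← Submodule.mem_span_range_iff_exists_fun, hc]
      have := congrArg (fun t => τ.symm (MulOpposite.op t)) (hb j)
      simpa [Fintype.linearCombination_apply, a', map_sum, Finset.op_sum] using this
    choose s hs using hs
    have hb' : ∀ i j, b i j = ∑ l, (τ (c l i)).unop * (τ (s j l)).unop := fun i j => by
      have := congrArg (fun t => (τ t).unop) (congrFun (hs j) i)
      simpa [map_sum, Finset.unop_sum] using this.symm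
    refine ⟨fun l => ∑ j, (τ (s j l)).unop • z j, fun i => ?_⟩
    rw [hz i]
    simp_rw [hb', Finset.sum_smul, Finset.smul_sum, smul_smul]
    exact Finset.sum_comm
  choose y hy using key
  refine ⟨k, fun i l => (τ (c l i)).unop, fun l α => y α l, fun i => ?_, fun l => ?_⟩
  · ext α
    simp [hy α i]
  · have hl : c l ∈ LinearMap.ker (Fintype.linearCombination T a') := by
      rw [← hc]
      exact Submodule.subset_span ⟨l, rfl⟩
    have hl' : ∑ i, c l i * a' i = 0 := by
      simpa [Fintype.linearCombination_apply] using hl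
    have := congrArg (fun t => (τ t).unop) hl'
    simpa [a', map_sum, Finset.unop_sum] using this

end Dual

/-! ### Injective envelopes of flat modules -/

/-- An envelope of a module that embeds into a flat injective module is flat. -/
theorem EquationallyFlat.E0_of_embedding {S : Type u} [Ring S] {F P : Type u} [AddCommGroup F]
    [Module S F] [AddCommGroup P] [Module S P] (hP : EquationallyFlat S P)
    (hP' : Module.Injective S P) (f : F →ₗ[S] P) (hf : Function.Injective f) :
    EquationallyFlat S (E0 S F) := by
  have henv := E0.isInjectiveEnvelope S F
  obtain ⟨h, hh⟩ := hP'.out (E0.ι S F) henv.injective f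
  -- The extension `h` is injective on the image of `F`, hence injective by essentiality;
  -- injectivity of the envelope then splits it.
  have hker : LinearMap.ker h = ⊥ := henv.essential _ (by
    rw [Submodule.eq_bot_iff]
    rintro _ ⟨hx, y, rfl⟩
    have hy : f y = 0 := by rw [← hh]; exact hx
    rw [hf (hy.trans (map_zero f).symm), map_zero])
  obtain ⟨r, hr⟩ := henv.injective_module.out h (LinearMap.ker_eq_bot.1 hker) LinearMap.id
  exact hP.of_retract h r hr

/-- Maps from a flat module to an injective module containing the ring separate points. -/
theorem EquationallyFlat.exists_map_ne_zero {S : Type u} [Ring S] [IsNoetherianRing S]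
    {F E : Type u} [AddCommGroup F] [Module S F] [AddCommGroup E] [Module S E]
    (hF : EquationallyFlat S F) (hE : Module.Injective S E) (j : S →ₗ[S] E)
    (hj : Function.Injective j) {x : F} (hx : x ≠ 0) : ∃ f : F →ₗ[S] E, f x ≠ 0 := by
  let D : Ideal S := LinearMap.ker (LinearMap.toSpanSingleton S F x)
  obtain ⟨m, d, hd⟩ := Submodule.fg_iff_exists_fin_generating_family.1
    (IsNoetherian.noetherian D)
  -- Apply flatness to the finitely many equations `d l • x = 0`. Some coefficient `b 0 i` is
  -- nonzero and is killed by the whole annihilator of `x`, so `x ↦ j (b 0 i)` is well defined on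
  -- the span of `x` and extends to `F`.
  obtain ⟨k, b, y, hxy, hb⟩ := hF.exists_of_system m 1 (fun l _ => d l) (fun _ => x) (fun l => by
    have hl : d l ∈ D := by
      rw [← hd]
      exact Submodule.subset_span ⟨l, rfl⟩
    simpa [D] using hl)
  obtain ⟨i, hi⟩ : ∃ i, b 0 i ≠ 0 := by
    by_contra! H
    exact hx (by simpa [H] using hxy 0)
  have hle : D ≤ LinearMap.ker (LinearMap.toSpanSingleton S S (b 0 i)) := by
    rw [← hd, Submodule.span_le]
    rintro _ ⟨l, rfl⟩
    simpa using hb l i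
  obtain ⟨f, hf⟩ := exists_comp_eq_of_ker_le (Module.Baer.of_injective hE)
    (LinearMap.toSpanSingleton S F x) (j ∘ₗ LinearMap.toSpanSingleton S S (b 0 i))
    (fun t ht => by
      have := hle ht
      rw [LinearMap.mem_ker] at this
      simp only [LinearMap.mem_ker, LinearMap.comp_apply, this, map_zero])
  refine ⟨f, fun h0 => hi (hj ?_)⟩
  have := hf 1
  simp only [LinearMap.toSpanSingleton_apply, LinearMap.comp_apply, one_smul] at this
  rw [← this, h0, map_zero]

/-- `S` embeds into a flat injective `S`-module. -/
def HasFlatInjectiveExtension (S : Type u) [Ring S] : Prop :=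
  ∃ (E : ModuleCat.{u} S) (j : S →ₗ[S] E), Function.Injective j ∧
    Module.Injective S E ∧ EquationallyFlat S E

theorem HasFlatInjectiveExtension.E0 {S T : Type u} [Ring S] [Ring T] [IsNoetherianRing S]
    [IsNoetherianRing T] (τ : T ≃+* Sᵐᵒᵖ) (h : HasFlatInjectiveExtension S)
    {F : Type u} [AddCommGroup F] [Module S F] (hF : EquationallyFlat S F) :
    EquationallyFlat S (E0 S F) := by
  obtain ⟨E, j, hj, hE, hE'⟩ := h
  refine EquationallyFlat.E0_of_embedding
    (EquationallyFlat.pi τ (fun _ : F →ₗ[S] E => hE')) inferInstance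
    (LinearMap.pi fun f : F →ₗ[S] E => f) ?_
  rw [← LinearMap.ker_eq_bot, LinearMap.ker_eq_bot']
  intro x hx
  by_contra hx0
  obtain ⟨f, hf⟩ := hF.exists_map_ne_zero hE j hj hx0
  exact hf (congrFun hx f)

/-- For Noetherian `S` the existence of a flat injective extension passes to `Sᵐᵒᵖ`. -/
theorem HasFlatInjectiveExtension.opposite {S T : Type u} [Ring S] [Ring T] [IsNoetherianRing S]
    (τ : T ≃+* Sᵐᵒᵖ) (h : HasFlatInjectiveExtension S) :
    HasFlatInjectiveExtension T := by
  obtain ⟨E, j, hj, hE, hE'⟩ := h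
  have hinj : Module.Injective T (Dual τ E) := Module.Baer.injective hE'.baer_dual
  have hflat : EquationallyFlat T (Dual τ E) :=
    EquationallyFlat.dual_of_baer (Module.Baer.of_injective hE)
  let σ : S ≃+* Tᵐᵒᵖ := (RingEquiv.opOp S).trans τ.symm.op
  -- One factor for each `φ` in the dual, where `t` goes to `t • φ`. For `t ≠ 0` the coordinate at a
  -- character not vanishing on `(τ t).unop • j 1` is nonzero.
  refine ⟨ModuleCat.of T (Dual τ E → Dual τ E),
    LinearMap.pi fun φ => LinearMap.toSpanSingleton T _ φ, ?_,
    inferInstanceAs (Module.Injective T (Dual τ E → Dual τ E)),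
    EquationallyFlat.pi σ fun _ => hflat⟩
  rw [← LinearMap.ker_eq_bot, LinearMap.ker_eq_bot']
  intro t ht
  by_contra ht0
  have hne : (τ t).unop • j 1 ≠ 0 := by
    rw [← map_smul, smul_eq_mul, mul_one]
    intro h0
    have := hj (h0.trans (map_zero j).symm)
    exact ht0 (by simpa using this)
  obtain ⟨χ, hχ⟩ := exists_character_ne_zero hne
  have := congrArg (fun ξ : Dual τ E => ξ.toHom (j 1)) (congrFun ht (Dual.toHom.symm χ))
  exact hχ this

/-! ### Comparison with flatness in terms of tensor products -/

section Tensor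

variable {R : Type u} [Ring R] {N M : Type u} [AddCommGroup N] [Module Rᵐᵒᵖ N]
  [AddCommGroup M] [Module R M]

/-- The additive map out of `N ⊗_R M` given by a balanced biadditive map. -/
noncomputable def Tensor.lift {G : Type*} [AddCommGroup G] (f : N →+ M →+ G)
    (hf : ∀ x (r : R) y, f (MulOpposite.op r • x) y = f x (r • y)) : Tensor R N M →+ G :=
  QuotientAddGroup.lift _ (TensorProduct.liftAddHom f (fun r x y => by simp)) (by
    rw [balancedRel, AddSubgroup.closure_le]
    rintro _ ⟨x, r, y, rfl⟩
    simp [hf])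

/-- The class of `x ⊗ y`. -/
noncomputable def Tensor.mk (x : N) (y : M) : Tensor R N M :=
  QuotientAddGroup.mk (x ⊗ₜ[ℤ] y)

theorem Tensor.smul_mk (r : R) (x : N) (y : M) :
    (Tensor.mk (MulOpposite.op r • x) y : Tensor R N M) = Tensor.mk x (r • y) :=
  QuotientAddGroup.eq_iff_sub_mem.2 (AddSubgroup.subset_closure ⟨x, r, y, rfl⟩)

theorem Tensor.add_mk (x x' : N) (y : M) :
    (Tensor.mk (x + x') y : Tensor R N M) = Tensor.mk x y + Tensor.mk x' y :=
  congrArg QuotientAddGroup.mk (TensorProduct.add_tmul x x' y)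

theorem Tensor.mk_add (x : N) (y y' : M) :
    (Tensor.mk x (y + y') : Tensor R N M) = Tensor.mk x y + Tensor.mk x y' :=
  congrArg QuotientAddGroup.mk (TensorProduct.tmul_add x y y')

/-- The universal biadditive map to `N ⊗_R M`. -/
noncomputable def Tensor.mkHom : N →+ M →+ Tensor R N M :=
  AddMonoidHom.mk' (fun x => AddMonoidHom.mk' (Tensor.mk x) (Tensor.mk_add x))
    fun x x' => AddMonoidHom.ext fun y => Tensor.add_mk x x' y

theorem Tensor.hom_ext {G : Type*} [AddCommGroup G] {f g : Tensor R N M →+ G}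
    (h : ∀ x y, f (Tensor.mk x y) = g (Tensor.mk x y)) : f = g := by
  refine AddMonoidHom.ext fun t => ?_
  obtain ⟨t, rfl⟩ := QuotientAddGroup.mk_surjective t
  induction t using TensorProduct.induction_on with
  | zero => exact (map_zero f).trans (map_zero g).symm
  | tmul x y => exact h x y
  | add s t hs ht =>
    rw [QuotientAddGroup.mk_add, map_add, map_add, hs, ht]

/-- By the adjunction `Hom(X, M⁺) ≅ (X ⊗ M)⁺`, extending maps into `M⁺` along a monomorphism amounts
to extending characters of the tensor products. As characters separate points, tensor flatness of
`M` is injectivity of `M⁺`. -/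
theorem isFlatLeft_iff : IsFlatLeft R M ↔ EquationallyFlat R M := by
  let τ : Rᵐᵒᵖ ≃+* Rᵐᵒᵖ := RingEquiv.refl _
  constructor
  · intro h
    refine EquationallyFlat.of_baer_dual (τ := τ) (Module.Baer.of_injective ⟨?_⟩)
    intro X Y _ _ _ _ f hf g
    obtain ⟨k, hk⟩ := exists_character_comp_eq (Tensor.map f (LinearMap.id : M →ₗ[R] M))
      (Tensor.lift ((Dual.toHom (τ := τ)).toAddMonoidHom.comp g.toAddMonoidHom) (fun x r y => by
        change (g (MulOpposite.op r • x)).toHom y = _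
        rw [map_smul]
        rfl))
      (fun t ht => by rw [h X Y f hf (ht.trans (map_zero _).symm), map_zero])
    refine ⟨⟨⟨fun y => Dual.toHom.symm (k.comp (Tensor.mkHom y)), fun y y' => ?_⟩, fun r y => ?_⟩,
      fun x => Dual.ext fun m => hk (Tensor.mk x m)⟩
    · refine Dual.ext fun m => ?_
      change k (Tensor.mk (y + y') m) = k (Tensor.mk y m) + k (Tensor.mk y' m)
      rw [Tensor.add_mk, map_add]
    · refine Dual.ext fun m => ?_
      change k (Tensor.mk (MulOpposite.op r.unop • y) m) = k (Tensor.mk y (r.unop • m))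
      rw [Tensor.smul_mk]
  · intro h A B _ _ _ _ f hf
    rw [injective_iff_map_eq_zero]
    intro t ht
    by_contra ht0
    obtain ⟨χ, hχ⟩ := exists_character_ne_zero ht0
    obtain ⟨g, hg⟩ := (Module.Baer.injective (h.baer_dual (τ := τ))).out f hf
      ⟨⟨fun x => Dual.toHom.symm (χ.comp (Tensor.mkHom x)), fun x x' => Dual.ext fun m => by
        change χ (Tensor.mk (x + x') m) = χ (Tensor.mk x m) + χ (Tensor.mk x' m)
        rw [Tensor.add_mk, map_add]⟩, fun r x => Dual.ext fun m => by
        change χ (Tensor.mk (MulOpposite.op r.unop • x) m) = χ (Tensor.mk x (r.unop • m))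
        rw [Tensor.smul_mk]⟩
    let G := Tensor.lift (R := R) ((Dual.toHom (τ := τ)).toAddMonoidHom.comp g.toAddMonoidHom)
      (fun x r y => by
        change (g (MulOpposite.op r • x)).toHom y = _
        rw [map_smul]
        rfl)
    have hG : G.comp (Tensor.map f (LinearMap.id : M →ₗ[R] M)) = χ := Tensor.hom_ext fun x y =>
      congrArg (fun ξ : Dual τ M => ξ.toHom y) (hg x)
    apply hχ
    rw [← hG, AddMonoidHom.comp_apply, ht, map_zero]

theorem isFlatRight_iff : IsFlatRight R N ↔ EquationallyFlat Rᵐᵒᵖ N := by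
  let τ : R ≃+* Rᵐᵒᵖᵐᵒᵖ := RingEquiv.opOp R
  constructor
  · intro h
    refine EquationallyFlat.of_baer_dual (τ := τ) (Module.Baer.of_injective ⟨?_⟩)
    intro X Y _ _ _ _ f hf g
    obtain ⟨k, hk⟩ := exists_character_comp_eq (Tensor.map (LinearMap.id : N →ₗ[Rᵐᵒᵖ] N) f)
      (Tensor.lift ((Dual.toHom (τ := τ)).toAddMonoidHom.comp g.toAddMonoidHom).flip
        (fun x r y => by
          change (g y).toHom (MulOpposite.op r • x) = (g (r • y)).toHom x
          rw [g.map_smul]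
          rfl))
      (fun t ht => by rw [h X Y f hf (ht.trans (map_zero _).symm), map_zero])
    refine ⟨⟨⟨fun y => Dual.toHom.symm (k.comp (Tensor.mkHom.flip y)), fun y y' => ?_⟩,
      fun r y => ?_⟩, fun x => Dual.ext fun m => hk (Tensor.mk m x)⟩
    · refine Dual.ext fun m => ?_
      change k (Tensor.mk m (y + y')) = k (Tensor.mk m y) + k (Tensor.mk m y')
      rw [Tensor.mk_add, map_add]
    · refine Dual.ext fun m => ?_
      change k (Tensor.mk m (r • y)) = k (Tensor.mk (MulOpposite.op r • m) y)
      rw [Tensor.smul_mk]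
  · intro h A B _ _ _ _ f hf
    rw [injective_iff_map_eq_zero]
    intro t ht
    by_contra ht0
    obtain ⟨χ, hχ⟩ := exists_character_ne_zero ht0
    obtain ⟨g, hg⟩ := (Module.Baer.injective (h.baer_dual (τ := τ))).out f hf
      ⟨⟨fun x => Dual.toHom.symm (χ.comp (Tensor.mkHom.flip x)), fun x x' => Dual.ext fun m => by
        change χ (Tensor.mk m (x + x')) = χ (Tensor.mk m x) + χ (Tensor.mk m x')
        rw [Tensor.mk_add, map_add]⟩, fun r x => Dual.ext fun m => by
        change χ (Tensor.mk m (r • x)) = χ (Tensor.mk (MulOpposite.op r • m) x)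
        rw [Tensor.smul_mk]⟩
    let G := Tensor.lift (R := R) ((Dual.toHom (τ := τ)).toAddMonoidHom.comp g.toAddMonoidHom).flip
      (fun x r y => by
        change (g y).toHom (MulOpposite.op r • x) = (g (r • y)).toHom x
        rw [g.map_smul]
        rfl)
    have hG : G.comp (Tensor.map (LinearMap.id : N →ₗ[Rᵐᵒᵖ] N) f) = χ :=
      Tensor.hom_ext fun x y => congrArg (fun ξ : Dual τ N => ξ.toHom x) (hg y)
    apply hχ
    rw [← hG, AddMonoidHom.comp_apply, ht, map_zero]

end Tensor

/-! ### Gorenstein flat modules -/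

/-- An injective module that is isomorphic to a submodule of a flat module is flat. -/
theorem EquationallyFlat.of_equiv_submodule {S M F : Type u} [Ring S] [AddCommGroup M] [Module S M]
    [AddCommGroup F] [Module S F] (hF : EquationallyFlat S F) (hM : Module.Injective S M)
    {P : Submodule S F} (e : M ≃ₗ[S] P) : EquationallyFlat S M := by
  obtain ⟨r, hr⟩ := hM.out (P.subtype ∘ₗ e.toLinearMap)
    (P.injective_subtype.comp e.injective) LinearMap.id
  exact hF.of_retract _ r hr

theorem Tensor.map_id_id {R : Type u} [Ring R] {N M : Type u} [AddCommGroup N] [Module Rᵐᵒᵖ N]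
    [AddCommGroup M] [Module R M] :
    Tensor.map (LinearMap.id : N →ₗ[Rᵐᵒᵖ] N) (LinearMap.id : M →ₗ[R] M) = AddMonoidHom.id _ :=
  Tensor.hom_ext fun _ _ => rfl

theorem Tensor.map_id_zero {R : Type u} [Ring R] {N M : Type u} [AddCommGroup N] [Module Rᵐᵒᵖ N]
    [AddCommGroup M] [Module R M] :
    Tensor.map (LinearMap.id : N →ₗ[Rᵐᵒᵖ] N) (0 : M →ₗ[R] M) = 0 :=
  Tensor.hom_ext fun x _ => map_zero (Tensor.mkHom x)

theorem Tensor.map_zero_id {R : Type u} [Ring R] {N M : Type u} [AddCommGroup N] [Module Rᵐᵒᵖ N]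
    [AddCommGroup M] [Module R M] :
    Tensor.map (0 : N →ₗ[Rᵐᵒᵖ] N) (LinearMap.id : M →ₗ[R] M) = 0 :=
  Tensor.hom_ext fun _ y => map_zero (Tensor.mkHom.flip y)

/-- The differential of the contractible complex `⋯ = M → M = M → M = ⋯`, in which identities
and zero maps alternate. -/
def alternating (S : Type*) [Ring S] (M : Type*) [AddCommGroup M] [Module S M] (n : ℤ) :
    M →ₗ[S] M :=
  if Even n then 0 else LinearMap.id

theorem alternating_cases (S : Type*) [Ring S] (M : Type*) [AddCommGroup M] [Module S M] (n : ℤ) :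
    (alternating S M n = 0 ∧ alternating S M (n + 1) = LinearMap.id) ∨
      (alternating S M n = LinearMap.id ∧ alternating S M (n + 1) = 0) := by
  by_cases h : Even n
  · exact Or.inl ⟨if_pos h, if_neg (by simpa [Int.even_add_one] using h)⟩
  · exact Or.inr ⟨if_neg h, if_pos (by simpa [Int.even_add_one] using h)⟩

theorem alternating_neg_one (S : Type*) [Ring S] (M : Type*) [AddCommGroup M] [Module S M] :
    alternating S M (-1) = LinearMap.id :=
  if_neg (by decide)

theorem alternating_exact (S : Type*) [Ring S] (M : Type*) [AddCommGroup M] [Module S M] (n : ℤ) :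
    Function.Exact (alternating S M n) (alternating S M (n + 1)) := by
  rcases alternating_cases S M n with ⟨h, h'⟩ | ⟨h, h'⟩ <;> rw [h, h'] <;> intro x <;>
    simp [eq_comm]

/-- The range of the differential in degree `-1`. -/
noncomputable def alternatingRangeEquiv (S : Type*) [Ring S] (M : Type*) [AddCommGroup M]
    [Module S M] : M ≃ₗ[S] LinearMap.range (alternating S M (-1)) :=
  (LinearEquiv.ofTop _ (by rw [alternating_neg_one, LinearMap.range_id])).symm

/-- Tensoring preserves identities and zero maps, so the alternating complex stays exact. -/
theorem IsFlatLeft.isGorensteinFlatLeft {R : Type u} [Ring R] {M : Type u} [AddCommGroup M]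
    [Module R M] (h : IsFlatLeft R M) : IsGorensteinFlatLeft R M := by
  refine ⟨fun _ => ModuleCat.of R M, alternating R M, fun _ => h, alternating_exact R M,
    ⟨alternatingRangeEquiv R M⟩, fun I _ _ _ n => ?_⟩
  rcases alternating_cases R M n with ⟨h, h'⟩ | ⟨h, h'⟩ <;> rw [h, h'] <;> intro x <;>
    simp [Tensor.map_id_id, Tensor.map_id_zero, eq_comm]

theorem IsFlatRight.isGorensteinFlatRight {R : Type u} [Ring R] {N : Type u} [AddCommGroup N]
    [Module Rᵐᵒᵖ N] (h : IsFlatRight R N) : IsGorensteinFlatRight R N := by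
  refine ⟨fun _ => ModuleCat.of Rᵐᵒᵖ N, alternating Rᵐᵒᵖ N, fun _ => h, alternating_exact Rᵐᵒᵖ N,
    ⟨alternatingRangeEquiv Rᵐᵒᵖ N⟩, fun I _ _ _ n => ?_⟩
  rcases alternating_cases Rᵐᵒᵖ N n with ⟨h, h'⟩ | ⟨h, h'⟩ <;> rw [h, h'] <;> intro x <;>
    simp [Tensor.map_id_id, Tensor.map_zero_id, eq_comm]

theorem IsGorensteinFlatLeft.isFlatLeft_of_injective {R : Type u} [Ring R] {M : Type u}
    [AddCommGroup M] [Module R M] (h : IsGorensteinFlatLeft R M) (hM : Module.Injective R M) :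
    IsFlatLeft R M := by
  obtain ⟨F, d, hF, -, ⟨e⟩, -⟩ := h
  exact isFlatLeft_iff.2 ((isFlatLeft_iff.1 (hF _)).of_equiv_submodule hM e)

theorem IsGorensteinFlatRight.isFlatRight_of_injective {R : Type u} [Ring R] {N : Type u}
    [AddCommGroup N] [Module Rᵐᵒᵖ N] (h : IsGorensteinFlatRight R N)
    (hN : Module.Injective Rᵐᵒᵖ N) : IsFlatRight R N := by
  obtain ⟨F, d, hF, -, ⟨e⟩, -⟩ := h
  exact isFlatRight_iff.2 ((isFlatRight_iff.1 (hF _)).of_equiv_submodule hN e)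

/-- The ring as a right module over itself is free of rank one. -/
def opEquivSelf (R : Type*) [Ring R] : Rᵐᵒᵖ ≃ₗ[Rᵐᵒᵖ] R where
  toFun := MulOpposite.unop
  invFun := MulOpposite.op
  map_add' _ _ := rfl
  map_smul' _ _ := rfl
  left_inv _ := rfl
  right_inv _ := rfl

/-- The envelope of a free module of rank one witnesses a flat injective extension. -/
theorem HasFlatInjectiveExtension.of_E0 {S M : Type u} [Ring S] [AddCommGroup M] [Module S M]
    (e : S ≃ₗ[S] M) (h : EquationallyFlat S (GorFlat.E0 S M)) : HasFlatInjectiveExtension S :=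
  ⟨GorFlat.E0 S M, E0.ι S M ∘ₗ e.toLinearMap,
    (E0.isInjectiveEnvelope S M).injective.comp e.injective,
    (E0.isInjectiveEnvelope S M).injective_module, h⟩

end GorFlat

open GorFlat

theorem corollary4p2 {R : Type u} [Ring R] [IsNoetherianRing R] [IsNoetherianRing Rᵐᵒᵖ] :
    List.TFAE [
      GorFlat.IsFlatLeft R (GorFlat.E0 R R),
      ∀ (F : Type u) [AddCommGroup F] [Module R F],
        GorFlat.IsFlatLeft R F → GorFlat.IsFlatLeft R (GorFlat.E0 R F),
      GorFlat.IsGorensteinFlatLeft R (GorFlat.E0 R R),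
      GorFlat.IsFlatRight R (GorFlat.E0 Rᵐᵒᵖ R),
      ∀ (F : Type u) [AddCommGroup F] [Module Rᵐᵒᵖ F],
        GorFlat.IsFlatRight R F → GorFlat.IsFlatRight R (GorFlat.E0 Rᵐᵒᵖ F),
      GorFlat.IsGorensteinFlatRight R (GorFlat.E0 Rᵐᵒᵖ R)] := by
  have flat_left : IsFlatLeft R R := isFlatLeft_iff.2 (EquationallyFlat.self R)
  have flat_right : IsFlatRight R R := isFlatRight_iff.2 ((EquationallyFlat.self Rᵐᵒᵖ).of_retract
    (opEquivSelf R).symm.toLinearMap (opEquivSelf R).toLinearMap fun _ => rfl)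
  have extension_left (h : IsFlatLeft R (E0 R R)) : HasFlatInjectiveExtension R :=
    .of_E0 (LinearEquiv.refl R R) (isFlatLeft_iff.1 h)
  have extension_right (h : IsFlatRight R (E0 Rᵐᵒᵖ R)) : HasFlatInjectiveExtension Rᵐᵒᵖ :=
    .of_E0 (opEquivSelf R) (isFlatRight_iff.1 h)
  tfae_have 2 → 1 := fun h => h R flat_left
  tfae_have 5 → 4 := fun h => h R flat_right
  tfae_have 1 → 3 := fun h => h.isGorensteinFlatLeft
  tfae_have 3 → 1 := fun h =>
    h.isFlatLeft_of_injective (E0.isInjectiveEnvelope R R).injective_module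
  tfae_have 4 → 6 := fun h => h.isGorensteinFlatRight
  tfae_have 6 → 4 := fun h =>
    h.isFlatRight_of_injective (E0.isInjectiveEnvelope Rᵐᵒᵖ R).injective_module
  -- This and 4 → 2 are the only links between the two sides; together with 5 → 4 and 2 → 1 they
  -- close the cycle.
  tfae_have 1 → 5 := fun h F _ _ hF => isFlatRight_iff.2
    (((extension_left h).opposite (RingEquiv.refl _)).E0 (RingEquiv.opOp R)
      (isFlatRight_iff.1 hF))
  tfae_have 4 → 2 := fun h F _ _ hF => isFlatLeft_iff.2
    (((extension_right h).opposite (RingEquiv.opOp R)).E0 (RingEquiv.refl _)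
      (isFlatLeft_iff.1 hF))
  tfae_finish
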